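/- Let $d\in\mathbb{N}$, let $N$ be a standard Gaussian random vector in $\mathbb{R}^d$ defined on a probability space $(\Omega,\mathcal{A},\mathsf{P})$, that is, $N$ has law $\mathcal{N}(0,I_d)$, and let $f:\mathbb{R}^d\to\mathbb{R}$ be Lipschitz with constant $L\ge 0$ with respect to the Euclidean norm, that is, $|f(x)-f(y)|\le L\|x-y\|$ for all $x,y\in\mathbb{R}^d$. Then $f(N)$ is integrable; for every $\lambda\in\mathbb{R}$ the random variable $\exp\bigl(\lambda(f(N)-\mathsf{E}f(N))\bigr)$ is integrable and $$\mathsf{E}\exp\bigl(\lambda\,(f(N)-\mathsf{E}f(N))\bigr)\le\exp\left(\frac{\lambda^2L^2}{2}\right);$$ and, if $L>0$, then for every $C\ge 0$ $$\mathsf{P}\left\{f(N)-\mathsf{E}f(N)\ge C\right\}\le\exp\left(-\frac{C^2}{2L^2}\right).$$ If $L=0$, then $\mathsf{P}\left\{f(N)-\mathsf{E}f(N)\ge C\right\}=0$ for every $C>0$. -/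

import Mathlib

open MeasureTheory ProbabilityTheory
open scoped NNReal

/-!
The argument is a discrete-time martingale computation with second-order Taylor expansion; it
gives the sharp constant `L ^ 2 / 2` without stochastic calculus or a logarithmic Sobolev
inequality.

A standard Gaussian vector is a sum of `m ^ 2` independent Gaussian increments of scale `1 / m`
(`isotropicGaussian_conv`). Let `g` be `L`-Lipschitz with a linear approximation `A x` at each point
whose error is quadratic, uniformly in `x` (`HasUniformTaylor`). For one increment `Y` of scale `c`,
expanding the exponential to second order gives
`E exp (g (x + Y)) ≤ exp (c ^ 2 * L ^ 2 / 2 + O(c ^ 3)) * exp (E g (x + Y))`, because the variance of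
`A x Y` is `c ^ 2 * ‖A x‖ ^ 2 ≤ c ^ 2 * L ^ 2`
(`HasUniformTaylor.integral_exp_isotropicGaussian_le`). The function `x ↦ E g (x + Y)` satisfies the
same hypotheses with the same constants (`HasUniformTaylor.average`), so the estimate iterates. After
`m ^ 2` steps the exponent is `L ^ 2 / 2 + O(1 / m)`, and `m → ∞` yields
`E exp (g Z) ≤ exp (L ^ 2 / 2 + E g Z)` (`HasUniformTaylor.integral_exp_stdGaussian_le`).

A compactly supported Lipschitz function is a uniform limit of smooth compactly supported functions
with the same Lipschitz constant, and these have a uniform Taylor expansion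
(`LipschitzWith.exists_hasUniformTaylor_dist_le`). A general Lipschitz function is reduced to that
case by clamping it between `± max 0 (R - L * ‖x‖)` (`coneTruncation`), which does not increase the
Lipschitz constant, and by dominated convergence as `R → ∞`. Applied to the multiples `t • f`, this
says that `f - E f` is sub-Gaussian with parameter `L ^ 2`, and the tail bound is Chernoff's.
-/

open Filter Topology Convolution

/-! ### Integrability under Gaussian measures -/

lemma LipschitzWith.abs_le_abs_zero_add {E : Type*} [SeminormedAddCommGroup E] {f : E → ℝ}
    {L : ℝ≥0} (hf : LipschitzWith L f) (x : E) : |f x| ≤ |f 0| + L * ‖x‖ := by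
  have h := hf.norm_sub_le x 0
  rw [Real.norm_eq_abs, sub_zero] at h
  have := abs_add_le (f x - f 0) (f 0)
  rw [sub_add_cancel] at this
  linarith

lemma LipschitzWith.comp_const_add {E : Type*} [SeminormedAddCommGroup E] {f : E → ℝ}
    {L : ℝ≥0} (hf : LipschitzWith L f) (x : E) : LipschitzWith L fun y ↦ f (x + y) :=
  LipschitzWith.of_dist_le_mul fun y y' ↦ by simpa using hf.dist_le_mul (x + y) (x + y')

section Integrability

variable {E : Type*} [NormedAddCommGroup E] [NormedSpace ℝ E] [CompleteSpace E]
  [SecondCountableTopology E] [MeasurableSpace E] [BorelSpace E]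
  (μ : Measure E) [IsGaussian μ]

lemma ProbabilityTheory.IsGaussian.integrable_exp_mul_norm (c : ℝ) :
    Integrable (fun x ↦ Real.exp (c * ‖x‖)) μ := by
  obtain ⟨C, hC, hint⟩ := IsGaussian.exists_integrable_exp_sq μ
  refine (hint.const_mul (Real.exp (c ^ 2 / (4 * C)))).mono'
    (by fun_prop) (ae_of_all _ fun x ↦ ?_)
  rw [Real.norm_eq_abs, Real.abs_exp, ← Real.exp_add, Real.exp_le_exp]
  have h : c ^ 2 / (4 * C) + C * ‖x‖ ^ 2 - c * ‖x‖ = C * (‖x‖ - c / (2 * C)) ^ 2 := by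
    field_simp
    ring
  nlinarith [mul_nonneg hC.le (sq_nonneg (‖x‖ - c / (2 * C)))]

lemma ProbabilityTheory.IsGaussian.integrable_pow_mul_exp_mul_norm (n : ℕ) (c : ℝ) :
    Integrable (fun x ↦ ‖x‖ ^ n * Real.exp (c * ‖x‖)) μ := by
  refine ((IsGaussian.integrable_exp_mul_norm μ (c + 1)).const_mul (n.factorial : ℝ)).mono'
    (by fun_prop) (ae_of_all _ fun x ↦ ?_)
  rw [Real.norm_of_nonneg (by positivity), add_mul, one_mul, Real.exp_add, mul_comm (Real.exp _),
    ← mul_assoc]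
  gcongr
  have := Real.pow_div_factorial_le_exp ‖x‖ (norm_nonneg x) n
  rwa [div_le_iff₀' (by positivity)] at this

variable {f : E → ℝ} {L : ℝ≥0}

lemma LipschitzWith.integrable_isGaussian (hf : LipschitzWith L f) : Integrable f μ := by
  refine ((integrable_const |f 0|).add
    ((IsGaussian.integrable_id (μ := μ)).norm.const_mul (L : ℝ))).mono'
    hf.continuous.aestronglyMeasurable (ae_of_all _ fun x ↦ hf.abs_le_abs_zero_add x)

lemma LipschitzWith.integrable_exp_isGaussian (hf : LipschitzWith L f) :
    Integrable (fun x ↦ Real.exp (f x)) μ := by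
  refine ((IsGaussian.integrable_exp_mul_norm μ L).const_mul (Real.exp |f 0|)).mono'
    (Real.continuous_exp.comp hf.continuous).aestronglyMeasurable (ae_of_all _ fun x ↦ ?_)
  rw [Real.norm_eq_abs, Real.abs_exp, ← Real.exp_add, Real.exp_le_exp]
  exact (le_abs_self _).trans (hf.abs_le_abs_zero_add x)

end Integrability

/-! ### Isotropic Gaussian measures and their convolution semigroup -/

section Isotropic

variable (E : Type*) [NormedAddCommGroup E] [InnerProductSpace ℝ E] [FiniteDimensional ℝ E]
  [MeasurableSpace E]

/-- The law of `c • Z`, where `Z` is a standard Gaussian vector in `E`; the covariance is `c ^ 2`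
times the identity. The parameter is the scale `c`, not the variance. -/
noncomputable def isotropicGaussian (c : ℝ) : Measure E := (stdGaussian E).map (c • ·)

lemma isotropicGaussian_one : isotropicGaussian E 1 = stdGaussian E := by
  simp [isotropicGaussian]

variable [BorelSpace E]

instance isGaussian_isotropicGaussian (c : ℝ) : IsGaussian (isotropicGaussian E c) :=
  inferInstanceAs (IsGaussian ((stdGaussian E).map (c • ContinuousLinearMap.id ℝ E)))

lemma isotropicGaussian_zero : isotropicGaussian E 0 = Measure.dirac 0 := by
  simp [isotropicGaussian, Measure.map_const]

lemma isotropicGaussian_conv (a b : ℝ) :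
    isotropicGaussian E a ∗ isotropicGaussian E b = isotropicGaussian E √(a ^ 2 + b ^ 2) := by
  refine Measure.ext_of_charFun (funext fun t ↦ ?_)
  simp only [charFun_conv, isotropicGaussian, charFun_map_smul, charFun_stdGaussian,
    ← Complex.exp_add, norm_smul, Real.norm_eq_abs]
  congr 1
  norm_cast
  simp only [mul_pow, sq_abs, Real.sq_sqrt (add_nonneg (sq_nonneg a) (sq_nonneg b))]
  ring

variable {E}

lemma integral_isotropicGaussian {f : E → ℝ} (hf : Continuous f) (c : ℝ) :
    ∫ y, f y ∂isotropicGaussian E c = ∫ z, f (c • z) ∂stdGaussian E :=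
  integral_map (by fun_prop) hf.aestronglyMeasurable

lemma integral_sq_strongDual_isotropicGaussian (A : StrongDual ℝ E) (c : ℝ) :
    ∫ y, A y ^ 2 ∂isotropicGaussian E c = c ^ 2 * ‖A‖ ^ 2 := by
  rw [integral_isotropicGaussian (by fun_prop), ← variance_dual_stdGaussian,
    variance_of_integral_eq_zero (by fun_prop) (integral_strongDual_stdGaussian A),
    ← integral_const_mul]
  simp [mul_pow]

lemma integral_pow_mul_exp_isotropicGaussian_le {c : ℝ} (hc : 0 ≤ c) (hc1 : c ≤ 1) (n : ℕ)
    (L : ℝ≥0) :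
    ∫ y, ‖y‖ ^ n * Real.exp (L * ‖y‖) ∂isotropicGaussian E c
      ≤ c ^ n * ∫ z, ‖z‖ ^ n * Real.exp (L * ‖z‖) ∂stdGaussian E := by
  rw [integral_isotropicGaussian (by fun_prop), ← integral_const_mul]
  refine integral_mono_of_nonneg (ae_of_all _ fun z ↦ by positivity)
    ((IsGaussian.integrable_pow_mul_exp_mul_norm _ n L).const_mul _) (ae_of_all _ fun z ↦ ?_)
  simp only [norm_smul, Real.norm_of_nonneg hc, mul_pow, mul_assoc]
  gcongr
  exact mul_le_of_le_one_left (norm_nonneg z) hc1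

end Isotropic

/-! ### Functions with a uniform first-order Taylor expansion -/

lemma Real.exp_le_one_add_add_sq_div_two_add (w : ℝ) :
    Real.exp w ≤ 1 + w + w ^ 2 / 2 + |w| ^ 3 * Real.exp |w| := by
  have h := Complex.norm_exp_sub_sum_le_norm_mul_exp (w : ℂ) 3
  rw [Complex.norm_real, Real.norm_eq_abs] at h
  have h2 : Complex.exp w - ∑ m ∈ Finset.range 3, (w : ℂ) ^ m / (m.factorial : ℂ)
      = ((Real.exp w - (1 + w + w ^ 2 / 2) : ℝ) : ℂ) := by
    simp [Finset.sum_range_succ, Nat.factorial]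
  rw [h2, Complex.norm_real, Real.norm_eq_abs] at h
  linarith [le_abs_self (Real.exp w - (1 + w + w ^ 2 / 2))]

/-- `g` is `L`-Lipschitz and has at each point `x` the linear approximation `A x`, of norm at most
`L` and continuous in `x`, with error at most `K * ‖y‖ ^ 2` uniformly in `x`. Recording `A` as data
rather than as the derivative of `g` makes the class visibly stable under averaging over
translations. -/
structure HasUniformTaylor {E : Type*} [NormedAddCommGroup E] [NormedSpace ℝ E]
    (g : E → ℝ) (A : E → StrongDual ℝ E) (L K : ℝ≥0) : Prop where
  lipschitz : LipschitzWith L g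
  continuous : Continuous A
  norm_le : ∀ x, ‖A x‖ ≤ L
  taylor : ∀ x y, |g (x + y) - g x - A x y| ≤ K * ‖y‖ ^ 2

namespace HasUniformTaylor

section Basic

variable {E : Type*} [NormedAddCommGroup E] [NormedSpace ℝ E]
  {g : E → ℝ} {A : E → StrongDual ℝ E} {L K : ℝ≥0}

lemma exp_sub_le (hg : HasUniformTaylor g A L K) (x y : E) :
    Real.exp (g (x + y) - g x) ≤ 1 + (g (x + y) - g x) + A x y ^ 2 / 2
      + (K * L + L ^ 3) * (‖y‖ ^ 3 * Real.exp (L * ‖y‖)) := by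
  set w := g (x + y) - g x
  have hwL : |w| ≤ L * ‖y‖ := by simpa using hg.lipschitz.norm_sub_le (x + y) x
  have hAL : |A x y| ≤ L * ‖y‖ := (A x).le_of_opNorm_le (hg.norm_le x) y
  have hsq : w ^ 2 / 2 ≤ A x y ^ 2 / 2 + K * L * ‖y‖ ^ 3 := by
    have h1 : w ^ 2 - A x y ^ 2 ≤ |w - A x y| * |w + A x y| := by
      rw [← abs_mul]
      exact (le_abs_self _).trans_eq (by ring_nf)
    have h2 : |w - A x y| * |w + A x y| ≤ (K * ‖y‖ ^ 2) * (L * ‖y‖ + L * ‖y‖) :=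
      mul_le_mul (hg.taylor x y) ((abs_add_le _ _).trans (add_le_add hwL hAL)) (abs_nonneg _)
        (by positivity)
    linarith
  have hexp : 1 ≤ Real.exp (L * ‖y‖) := Real.one_le_exp (by positivity)
  calc Real.exp w ≤ 1 + w + w ^ 2 / 2 + |w| ^ 3 * Real.exp |w| :=
        Real.exp_le_one_add_add_sq_div_two_add w
    _ ≤ 1 + w + (A x y ^ 2 / 2 + K * L * ‖y‖ ^ 3) + (L * ‖y‖) ^ 3 * Real.exp (L * ‖y‖) := by
        gcongr
    _ ≤ 1 + w + (A x y ^ 2 / 2 + K * L * ‖y‖ ^ 3 * Real.exp (L * ‖y‖))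
        + (L * ‖y‖) ^ 3 * Real.exp (L * ‖y‖) := by
        have := le_mul_of_one_le_right (by positivity : (0 : ℝ) ≤ K * L * ‖y‖ ^ 3) hexp
        linarith
    _ = _ := by ring

variable [CompleteSpace E] [SecondCountableTopology E] [MeasurableSpace E] [BorelSpace E]
  (μ : Measure E) [IsGaussian μ]

/-- The constants `L` and `K` do not deteriorate, which is what allows the one-increment estimate to
be iterated an unbounded number of times. -/
lemma average (hg : HasUniformTaylor g A L K) :
    HasUniformTaylor (fun x ↦ ∫ y, g (x + y) ∂μ) (fun x ↦ ∫ y, A (x + y) ∂μ) L K := by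
  have hgi (x : E) : Integrable (fun y ↦ g (x + y)) μ :=
    (hg.lipschitz.comp_const_add x).integrable_isGaussian μ
  have hAm (x : E) : AEStronglyMeasurable (fun y ↦ A (x + y)) μ :=
    (hg.continuous.comp (by fun_prop)).aestronglyMeasurable
  have hAi (x : E) : Integrable (fun y ↦ A (x + y)) μ :=
    (integrable_const (L : ℝ)).mono' (hAm x) (ae_of_all _ fun y ↦ hg.norm_le _)
  refine ⟨LipschitzWith.of_dist_le_mul fun x x' ↦ ?_, ?_, fun x ↦ ?_, fun x y ↦ ?_⟩
  · rw [dist_eq_norm, ← integral_sub (hgi x) (hgi x')]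
    refine (norm_integral_le_of_norm_le_const (C := L * dist x x')
      (ae_of_all _ fun y ↦ ?_)).trans_eq (by simp)
    simpa [dist_eq_norm] using hg.lipschitz.dist_le_mul (x + y) (x' + y)
  · exact continuous_of_dominated hAm (fun x ↦ ae_of_all _ fun y ↦ hg.norm_le _)
      (integrable_const (L : ℝ)) (ae_of_all _ fun y ↦ hg.continuous.comp (by fun_prop))
  · exact (norm_integral_le_of_norm_le_const (ae_of_all _ fun y ↦ hg.norm_le _)).trans_eq (by simp)
  · have hdiff : Integrable (fun z ↦ g (x + y + z) - g (x + z)) μ := (hgi _).sub (hgi _)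
    rw [ContinuousLinearMap.integral_apply (hAi x), ← integral_sub (hgi _) (hgi _),
      ← integral_sub hdiff ((hAi x).apply_continuousLinearMap y),
      ← Real.norm_eq_abs]
    refine (norm_integral_le_of_norm_le_const (C := K * ‖y‖ ^ 2)
      (ae_of_all _ fun z ↦ ?_)).trans_eq (by simp)
    simpa [add_right_comm] using hg.taylor (x + z) y

end Basic

variable {E : Type*} [NormedAddCommGroup E] [InnerProductSpace ℝ E] [FiniteDimensional ℝ E]
  [MeasurableSpace E] [BorelSpace E] {g : E → ℝ} {A : E → StrongDual ℝ E} {L K : ℝ≥0}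

/-- The estimate for a single small Gaussian increment. The variance term `L ^ 2 * c ^ 2 / 2` has
the sharp constant, and the error is of order `c ^ 3`. -/
lemma integral_exp_isotropicGaussian_le (hg : HasUniformTaylor g A L K) {c : ℝ} (hc : 0 ≤ c)
    (hc1 : c ≤ 1) (x : E) :
    ∫ y, Real.exp (g (x + y)) ∂isotropicGaussian E c
      ≤ Real.exp (c ^ 2 * L ^ 2 / 2
          + c ^ 3 * ((K * L + L ^ 3) * ∫ z, ‖z‖ ^ 3 * Real.exp (L * ‖z‖) ∂stdGaussian E))
        * Real.exp (∫ y, g (x + y) ∂isotropicGaussian E c) := by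
  set μ := isotropicGaussian E c
  have hlip := hg.lipschitz.comp_const_add x
  have hgi : Integrable (fun y ↦ g (x + y) - g x) μ :=
    (hlip.integrable_isGaussian μ).sub (integrable_const _)
  have hAi : Integrable (fun y ↦ A x y ^ 2) μ :=
    (IsGaussian.memLp_dual μ (A x) 2 (by simp)).integrable_sq
  have hRi := IsGaussian.integrable_pow_mul_exp_mul_norm μ 3 L
  have hsplit (y : E) :
      Real.exp (g (x + y)) = Real.exp (g x) * Real.exp (g (x + y) - g x) := by
    rw [← Real.exp_add]; ring_nf
  have hint : Integrable (fun y ↦ Real.exp (g (x + y) - g x)) μ := by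
    refine ((hlip.integrable_exp_isGaussian μ).const_mul (Real.exp (-g x))).congr
      (ae_of_all _ fun y ↦ ?_)
    simp only [← Real.exp_add]; ring_nf
  have hbound : ∫ y, Real.exp (g (x + y) - g x) ∂μ
      ≤ 1 + ∫ y, (g (x + y) - g x) ∂μ + (∫ y, A x y ^ 2 ∂μ) / 2
        + (K * L + L ^ 3) * ∫ y, ‖y‖ ^ 3 * Real.exp (L * ‖y‖) ∂μ := by
    refine (integral_mono hint ((((integrable_const 1).add hgi).add (hAi.div_const 2)).add
      (hRi.const_mul _)) fun y ↦ hg.exp_sub_le x y).trans_eq ?_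
    rw [integral_add' (((integrable_const 1).add hgi).add (hAi.div_const 2)) (hRi.const_mul _),
      integral_add' ((integrable_const 1).add hgi) (hAi.div_const 2),
      integral_add' (integrable_const 1) hgi, integral_const_mul, integral_div]
    simp
  have hA : ∫ y, A x y ^ 2 ∂μ ≤ c ^ 2 * L ^ 2 := by
    rw [integral_sq_strongDual_isotropicGaussian]
    gcongr
    exact hg.norm_le x
  have hR := integral_pow_mul_exp_isotropicGaussian_le (E := E) hc hc1 3 L
  have hmean : ∫ y, (g (x + y) - g x) ∂μ = ∫ y, g (x + y) ∂μ - g x := by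
    rw [integral_sub (hlip.integrable_isGaussian μ) (integrable_const _)]
    simp
  simp_rw [hsplit, integral_const_mul]
  rw [hmean] at hbound
  set M := ∫ z, ‖z‖ ^ 3 * Real.exp (L * ‖z‖) ∂stdGaussian E
  set m := ∫ y, g (x + y) ∂μ
  have hR' := mul_le_mul_of_nonneg_left hR (by positivity : (0 : ℝ) ≤ K * L + L ^ 3)
  -- the centred terms sum to `1 + t`, and `1 + t ≤ exp t`
  have hexp := Real.add_one_le_exp
    (c ^ 2 * L ^ 2 / 2 + c ^ 3 * ((K * L + L ^ 3) * M) + (m - g x))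
  calc Real.exp (g x) * ∫ y, Real.exp (g (x + y) - g x) ∂μ
      ≤ Real.exp (g x) *
        Real.exp (c ^ 2 * L ^ 2 / 2 + c ^ 3 * ((K * L + L ^ 3) * M) + (m - g x)) := by
        gcongr
        linarith
    _ = _ := by
        rw [← Real.exp_add, ← Real.exp_add]; ring_nf

/-- The estimate for a sum of `k` independent increments of scale `c`, obtained by integrating out
the increments one at a time. -/
lemma integral_exp_isotropicGaussian_sqrt_mul_le (hg : HasUniformTaylor g A L K) {c : ℝ}
    (hc : 0 ≤ c) (hc1 : c ≤ 1) (k : ℕ) :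
    ∫ x, Real.exp (g x) ∂isotropicGaussian E (√k * c)
      ≤ Real.exp (k * (c ^ 2 * L ^ 2 / 2
          + c ^ 3 * ((K * L + L ^ 3) * ∫ z, ‖z‖ ^ 3 * Real.exp (L * ‖z‖) ∂stdGaussian E)))
        * Real.exp (∫ x, g x ∂isotropicGaussian E (√k * c)) := by
  induction k generalizing g A with
  | zero => simp [isotropicGaussian_zero]
  | succ k ih =>
    set δ := c ^ 2 * L ^ 2 / 2
      + c ^ 3 * ((K * L + L ^ 3) * ∫ z, ‖z‖ ^ 3 * Real.exp (L * ‖z‖) ∂stdGaussian E)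
    have hconv : isotropicGaussian E (√(k + 1 : ℕ) * c)
        = isotropicGaussian E (√k * c) ∗ isotropicGaussian E c := by
      rw [isotropicGaussian_conv]
      congr 1
      rw [mul_pow, Real.sq_sqrt (by positivity), ← Real.sqrt_sq hc,
        ← Real.sqrt_mul (by positivity), Real.sq_sqrt (by positivity)]
      push_cast
      ring_nf
    have hexp := hg.lipschitz.integrable_exp_isGaussian (isotropicGaussian E (√(k + 1 : ℕ) * c))
    have hgi := hg.lipschitz.integrable_isGaussian (isotropicGaussian E (√(k + 1 : ℕ) * c))
    rw [hconv] at hexp hgi ⊢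
    have hav := hg.average (isotropicGaussian E c)
    rw [integral_conv hexp, integral_conv hgi]
    calc ∫ x, ∫ y, Real.exp (g (x + y)) ∂isotropicGaussian E c ∂isotropicGaussian E (√k * c)
        ≤ ∫ x, Real.exp δ * Real.exp (∫ y, g (x + y) ∂isotropicGaussian E c)
            ∂isotropicGaussian E (√k * c) :=
          integral_mono_of_nonneg (ae_of_all _ fun x ↦ integral_nonneg fun y ↦ by positivity)
            ((hav.lipschitz.integrable_exp_isGaussian _).const_mul _)
            (ae_of_all _ fun x ↦ hg.integral_exp_isotropicGaussian_le hc hc1 x)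
      _ ≤ Real.exp δ * (Real.exp (k * δ) * Real.exp
            (∫ x, ∫ y, g (x + y) ∂isotropicGaussian E c ∂isotropicGaussian E (√k * c))) := by
          rw [integral_const_mul]
          gcongr
          exact ih hav
      _ = _ := by
          rw [← mul_assoc, ← Real.exp_add]
          push_cast
          ring_nf

/-- Writing a standard Gaussian vector as a sum of `m ^ 2` increments of scale `1 / m`, the
cubic errors add up to `O(1 / m)` and disappear in the limit. -/
lemma integral_exp_stdGaussian_le (hg : HasUniformTaylor g A L K) :
    ∫ x, Real.exp (g x) ∂stdGaussian E
      ≤ Real.exp (L ^ 2 / 2) * Real.exp (∫ x, g x ∂stdGaussian E) := by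
  set B := (K * L + L ^ 3) * ∫ z, ‖z‖ ^ 3 * Real.exp (L * ‖z‖) ∂stdGaussian E
  have key (m : ℕ) : ∫ x, Real.exp (g x) ∂stdGaussian E
      ≤ Real.exp (L ^ 2 / 2 + 1 / ((m : ℝ) + 1) * B) * Real.exp (∫ x, g x ∂stdGaussian E) := by
    have hm : (0 : ℝ) < m + 1 := by positivity
    have h := hg.integral_exp_isotropicGaussian_sqrt_mul_le (c := 1 / ((m : ℝ) + 1))
      (by positivity) ((div_le_one hm).2 (by linarith [(Nat.cast_nonneg m : (0 : ℝ) ≤ m)]))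
      ((m + 1) ^ 2)
    have h1 : √(((m + 1) ^ 2 : ℕ) : ℝ) * (1 / ((m : ℝ) + 1)) = 1 := by
      push_cast
      rw [Real.sqrt_sq hm.le]
      field_simp
    rw [h1, isotropicGaussian_one] at h
    change _ ≤ Real.exp (_ * (_ + _ * B)) * _ at h
    refine h.trans_eq ?_
    congr 2
    push_cast
    field_simp
  have hlim : Tendsto (fun m : ℕ ↦
      Real.exp (L ^ 2 / 2 + 1 / ((m : ℝ) + 1) * B) * Real.exp (∫ x, g x ∂stdGaussian E)) atTop
      (𝓝 (Real.exp (L ^ 2 / 2 + 0 * B) * Real.exp (∫ x, g x ∂stdGaussian E))) :=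
    ((Real.continuous_exp.tendsto _).comp
      ((tendsto_one_div_add_atTop_nhds_zero_nat.mul_const B).const_add _)).mul_const _
  simpa using ge_of_tendsto' hlim key

end HasUniformTaylor

/-! ### Mollification and truncation of Lipschitz functions -/

/-- `f` clamped between `± max 0 (R - L * ‖x‖)`. This keeps an `L`-Lipschitz function `L`-Lipschitz
and, when `L > 0`, gives it compact support. -/
noncomputable def coneTruncation {E : Type*} [NormedAddCommGroup E] (f : E → ℝ) (L : ℝ≥0)
    (R : ℝ) (x : E) : ℝ :=
  max (-max 0 (R - L * ‖x‖)) (min (max 0 (R - L * ‖x‖)) (f x))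

section Truncation

variable {E : Type*} [NormedAddCommGroup E] {f : E → ℝ} {L : ℝ≥0}

lemma lipschitzWith_coneTruncation (hf : LipschitzWith L f) (R : ℝ) :
    LipschitzWith L (coneTruncation f L R) := by
  have hcone : LipschitzWith L fun x : E ↦ max 0 (R - L * ‖x‖) := by
    refine LipschitzWith.const_max (LipschitzWith.of_dist_le_mul fun x y ↦ ?_) 0
    rw [Real.dist_eq, sub_sub_sub_cancel_left, ← mul_sub, abs_mul, abs_of_nonneg L.coe_nonneg,
      dist_eq_norm, norm_sub_rev]
    gcongr
    exact abs_norm_sub_norm_le y x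
  have h := hcone.neg.max (hcone.min hf)
  rw [max_self, max_self] at h
  exact h

lemma abs_coneTruncation_le (f : E → ℝ) (L : ℝ≥0) (R : ℝ) (x : E) :
    |coneTruncation f L R x| ≤ max 0 (R - L * ‖x‖) := by
  have : 0 ≤ max 0 (R - L * ‖x‖) := le_max_left _ _
  rw [abs_le, coneTruncation]
  exact ⟨le_max_left _ _, max_le (by linarith) (min_le_left _ _)⟩

lemma coneTruncation_eq_self {R : ℝ} {x : E} (h : |f x| ≤ R - L * ‖x‖) :
    coneTruncation f L R x = f x := by
  obtain ⟨h1, h2⟩ := abs_le.1 h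
  have h3 : max 0 (R - L * ‖x‖) = R - L * ‖x‖ := max_eq_right ((abs_nonneg _).trans h)
  rw [coneTruncation, h3, min_eq_right h2, max_eq_right h1]

lemma abs_coneTruncation_le_abs (f : E → ℝ) (L : ℝ≥0) (R : ℝ) (x : E) :
    |coneTruncation f L R x| ≤ |f x| := by
  have h : 0 ≤ max 0 (R - L * ‖x‖) := le_max_left _ _
  rw [abs_le, coneTruncation]
  constructor
  · refine le_max_of_le_right (le_min ?_ (neg_abs_le _))
    linarith [abs_nonneg (f x)]
  · refine max_le ?_ ((min_le_right _ _).trans (le_abs_self _))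
    linarith [abs_nonneg (f x)]

lemma hasCompactSupport_coneTruncation [ProperSpace E] (f : E → ℝ) (hL : 0 < L) (R : ℝ) :
    HasCompactSupport (coneTruncation f L R) := by
  refine HasCompactSupport.intro (isCompact_closedBall (0 : E) (R / L)) fun x hx ↦ ?_
  have hL' : (0 : ℝ) < L := hL
  rw [mem_closedBall_zero_iff, not_le, div_lt_iff₀' hL'] at hx
  have h := abs_coneTruncation_le f L R x
  rw [max_eq_left (by linarith)] at h
  exact abs_nonpos_iff.1 h

end Truncation

lemma ContDiff.hasUniformTaylor_of_hasCompactSupport {E : Type*}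
    [NormedAddCommGroup E] [NormedSpace ℝ E] {g : E → ℝ} {L : ℝ≥0} (hg : ContDiff ℝ 2 g)
    (hlip : LipschitzWith L g) (hs : HasCompactSupport g) :
    ∃ K, HasUniformTaylor g (fderiv ℝ g) L K := by
  have hg' : ContDiff ℝ 1 (fderiv ℝ g) := hg.fderiv_right (by norm_num)
  obtain ⟨K, hK⟩ := hg'.lipschitzWith_of_hasCompactSupport (hs.fderiv ℝ) one_ne_zero
  refine ⟨K, hlip, hg'.continuous, fun x ↦ norm_fderiv_le_of_lipschitz ℝ hlip, fun x y ↦ ?_⟩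
  have h := (convex_segment x (x + y)).norm_image_sub_le_of_norm_hasFDerivWithin_le'
    (f := g) (f' := fderiv ℝ g) (φ := fderiv ℝ g x) (C := K * ‖y‖)
    (fun z _ ↦ (hg.differentiable (by norm_num) z).hasFDerivAt.hasFDerivWithinAt)
    (fun z hz ↦ (hK.norm_sub_le z x).trans ?_)
    (left_mem_segment ℝ x (x + y)) (right_mem_segment ℝ x (x + y))
  · rw [add_sub_cancel_left, Real.norm_eq_abs] at h
    linarith
  · have := norm_sub_le_of_mem_segment hz
    rw [add_sub_cancel_left] at this
    gcongr

section Approximation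

variable {E : Type*} [NormedAddCommGroup E] [InnerProductSpace ℝ E] [FiniteDimensional ℝ E]
  [MeasurableSpace E] [BorelSpace E]

lemma LipschitzWith.convolution_normed {h : E → ℝ} {L : ℝ≥0} (hh : LipschitzWith L h)
    (φ : ContDiffBump (0 : E)) (μ : Measure E) [μ.IsAddHaarMeasure] :
    LipschitzWith L (φ.normed μ ⋆[ContinuousLinearMap.lsmul ℝ ℝ, μ] h : E → ℝ) := by
  have hex := (φ.hasCompactSupport_normed (μ := μ)).convolutionExists_left_of_continuous_right
    (ContinuousLinearMap.lsmul ℝ ℝ) (μ := μ) φ.continuous_normed.locallyIntegrable hh.continuous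
  refine LipschitzWith.of_dist_le_mul fun x y ↦ ?_
  rw [dist_eq_norm]
  simp only [convolution]
  rw [← integral_sub (hex x) (hex y)]
  refine (norm_integral_le_of_norm_le ((φ.integrable_normed (μ := μ)).mul_const (L * dist x y))
    (ae_of_all _ fun t ↦ ?_)).trans_eq ?_
  · simp only [ContinuousLinearMap.lsmul_apply, smul_eq_mul, ← mul_sub, norm_mul,
      Real.norm_of_nonneg (φ.nonneg_normed t)]
    have := hh.dist_le_mul (x - t) (y - t)
    rw [dist_sub_right, Real.dist_eq] at this
    exact mul_le_mul_of_nonneg_left this (φ.nonneg_normed t)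
  · rw [integral_mul_const, φ.integral_normed, one_mul]

/-- Mollification at scale `ε` moves an `L`-Lipschitz function by at most `L * ε`. -/
lemma LipschitzWith.exists_hasUniformTaylor_dist_le {h : E → ℝ} {L : ℝ≥0}
    (hh : LipschitzWith L h) (hs : HasCompactSupport h) {ε : ℝ} (hε : 0 < ε) :
    ∃ g A K, HasUniformTaylor g A L K ∧ ∀ x, dist (g x) (h x) ≤ L * ε := by
  let φ : ContDiffBump (0 : E) := ⟨ε / 2, ε, by positivity, by linarith⟩
  let μ : Measure E := Measure.addHaar
  have hsmooth : ContDiff ℝ 2 (φ.normed μ ⋆[ContinuousLinearMap.lsmul ℝ ℝ, μ] h : E → ℝ) :=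
    φ.hasCompactSupport_normed.contDiff_convolution_left (n := 2) _ φ.contDiff_normed
      hh.continuous.locallyIntegrable
  obtain ⟨K, hK⟩ := hsmooth.hasUniformTaylor_of_hasCompactSupport (hh.convolution_normed φ μ)
    (φ.hasCompactSupport_normed.convolution _ hs)
  refine ⟨_, _, K, hK, fun x ↦ φ.dist_normed_convolution_le hh.continuous.aestronglyMeasurable
    fun y hy ↦ (hh.dist_le_mul y x).trans ?_⟩
  gcongr
  exact (Metric.mem_ball.1 hy).le

lemma LipschitzWith.integral_exp_stdGaussian_le_of_hasCompactSupport {h : E → ℝ} {L : ℝ≥0}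
    (hh : LipschitzWith L h) (hs : HasCompactSupport h) :
    ∫ x, Real.exp (h x) ∂stdGaussian E
      ≤ Real.exp (L ^ 2 / 2) * Real.exp (∫ x, h x ∂stdGaussian E) := by
  have hi := hh.integrable_isGaussian (stdGaussian E)
  have hei := hh.integrable_exp_isGaussian (stdGaussian E)
  have key (ε : ℝ) (hε : 0 < ε) : ∫ x, Real.exp (h x) ∂stdGaussian E
      ≤ Real.exp (2 * L * ε + L ^ 2 / 2) * Real.exp (∫ x, h x ∂stdGaussian E) := by
    obtain ⟨g, A, K, hg, hgh⟩ := hh.exists_hasUniformTaylor_dist_le hs hε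
    have hgi := hg.lipschitz.integrable_isGaussian (stdGaussian E)
    have hgei := hg.lipschitz.integrable_exp_isGaussian (stdGaussian E)
    have h1 : ∫ x, Real.exp (h x) ∂stdGaussian E
        ≤ Real.exp (L * ε) * ∫ x, Real.exp (g x) ∂stdGaussian E := by
      rw [← integral_const_mul]
      refine integral_mono hei (hgei.const_mul _) fun x ↦ ?_
      rw [← Real.exp_add, Real.exp_le_exp]
      linarith [(abs_le.1 (hgh x)).1]
    have h2 : ∫ x, g x ∂stdGaussian E ≤ ∫ x, h x ∂stdGaussian E + L * ε := by
      refine (integral_mono hgi (hi.add (integrable_const (L * ε))) fun x ↦ ?_).trans_eq ?_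
      · simp only [Pi.add_apply]
        linarith [(abs_le.1 (hgh x)).2]
      · simp only [Pi.add_apply]
        rw [integral_add hi (integrable_const _)]
        simp
    calc ∫ x, Real.exp (h x) ∂stdGaussian E
        ≤ Real.exp (L * ε) * (Real.exp (L ^ 2 / 2)
            * Real.exp (∫ x, h x ∂stdGaussian E + L * ε)) := by
          refine h1.trans ?_
          gcongr
          refine hg.integral_exp_stdGaussian_le.trans ?_
          gcongr
      _ = _ := by
          simp only [← Real.exp_add]; ring_nf
  have hlim : Tendsto (fun ε : ℝ ↦
      Real.exp (2 * L * ε + L ^ 2 / 2) * Real.exp (∫ x, h x ∂stdGaussian E)) (𝓝[>] 0)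
      (𝓝 (Real.exp (2 * L * 0 + L ^ 2 / 2) * Real.exp (∫ x, h x ∂stdGaussian E))) :=
    (Continuous.tendsto (by fun_prop) _).mono_left nhdsWithin_le_nhds
  simpa using ge_of_tendsto hlim (eventually_mem_nhdsWithin.mono key)

/-- The sharp exponential moment bound for Lipschitz functions of a standard Gaussian vector. -/
theorem LipschitzWith.integral_exp_stdGaussian_le {f : E → ℝ} {L : ℝ≥0}
    (hf : LipschitzWith L f) :
    ∫ x, Real.exp (f x) ∂stdGaussian E
      ≤ Real.exp (L ^ 2 / 2) * Real.exp (∫ x, f x ∂stdGaussian E) := by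
  -- the truncation has compact support only for `L > 0`
  obtain rfl | hL := eq_zero_or_pos L
  · have hconst (x : E) : f x = f 0 := by simpa [sub_eq_zero] using hf.norm_sub_le x 0
    simp [hconst]
  have hev (x : E) : ∀ᶠ n : ℕ in atTop, coneTruncation f L n x = f x := by
    filter_upwards [tendsto_natCast_atTop_atTop.eventually_ge_atTop (|f x| + L * ‖x‖)] with n hn
    exact coneTruncation_eq_self (by linarith)
  have hlip (n : ℕ) : LipschitzWith L (coneTruncation f L n) := lipschitzWith_coneTruncation hf n
  have hmean : Tendsto (fun n : ℕ ↦ ∫ x, coneTruncation f L n x ∂stdGaussian E) atTop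
      (𝓝 (∫ x, f x ∂stdGaussian E)) :=
    tendsto_integral_of_dominated_convergence (fun x ↦ |f x|)
      (fun n ↦ (hlip n).continuous.aestronglyMeasurable) (hf.integrable_isGaussian _).abs
      (fun n ↦ ae_of_all _ fun x ↦ abs_coneTruncation_le_abs f L n x)
      (ae_of_all _ fun x ↦ tendsto_const_nhds.congr' ((hev x).mono fun _ h ↦ h.symm))
  have hexp : Tendsto (fun n : ℕ ↦ ∫ x, Real.exp (coneTruncation f L n x) ∂stdGaussian E) atTop
      (𝓝 (∫ x, Real.exp (f x) ∂stdGaussian E)) := by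
    refine tendsto_integral_of_dominated_convergence (fun x ↦ Real.exp (f x) + Real.exp (-f x))
      (fun n ↦ (Real.continuous_exp.comp (hlip n).continuous).aestronglyMeasurable)
      ((hf.integrable_exp_isGaussian _).add (hf.neg.integrable_exp_isGaussian _))
      (fun n ↦ ae_of_all _ fun x ↦ ?_)
      (ae_of_all _ fun x ↦ tendsto_const_nhds.congr' ((hev x).mono fun _ h ↦ by simp only [h]))
    rw [Real.norm_eq_abs, Real.abs_exp]
    refine (Real.exp_le_exp.2 ((le_abs_self _).trans
      (abs_coneTruncation_le_abs f L n x))).trans ?_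
    rcases abs_choice (f x) with h | h <;> rw [h] <;>
      linarith [Real.exp_pos (f x), Real.exp_pos (-f x)]
  exact le_of_tendsto_of_tendsto' hexp
    (((Real.continuous_exp.tendsto _).comp hmean).const_mul _)
    fun n ↦ (hlip n).integral_exp_stdGaussian_le_of_hasCompactSupport
      (hasCompactSupport_coneTruncation f hL n)

lemma LipschitzWith.hasSubgaussianMGF_stdGaussian {f : E → ℝ} {L : ℝ≥0} (hf : LipschitzWith L f) :
    HasSubgaussianMGF (fun x ↦ f x - ∫ x', f x' ∂stdGaussian E) (L ^ 2) (stdGaussian E) := by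
  set m := ∫ x', f x' ∂stdGaussian E with hm
  have hlip (t : ℝ) : LipschitzWith (‖t‖₊ * L) fun x ↦ t * f x :=
    (lipschitzWith_smul t).comp hf
  have hsplit (t : ℝ) (x : E) :
      Real.exp (t * (f x - m)) = Real.exp (-(t * m)) * Real.exp (t * f x) := by
    rw [← Real.exp_add]; ring_nf
  refine ⟨fun t ↦ ?_, fun t ↦ ?_⟩
  · simp_rw [hsplit]
    exact ((hlip t).integrable_exp_isGaussian _).const_mul _
  · have h := (hlip t).integral_exp_stdGaussian_le
    rw [integral_const_mul, ← hm] at h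
    simp_rw [mgf, hsplit, integral_const_mul]
    calc Real.exp (-(t * m)) * ∫ x, Real.exp (t * f x) ∂stdGaussian E
        ≤ Real.exp (-(t * m)) * (Real.exp ((‖t‖₊ * L : ℝ≥0) ^ 2 / 2) * Real.exp (t * m)) := by
          gcongr
      _ = _ := by
          rw [← Real.exp_add, ← Real.exp_add]
          congr 1
          push_cast
          rw [Real.norm_eq_abs, mul_pow, sq_abs]
          ring

end Approximation

/-! ### Concentration -/

theorem theorem6p5 (d : ℕ) {Ω : Type*} [MeasurableSpace Ω] (P : Measure Ω)
    [IsProbabilityMeasure P] (N : Ω → EuclideanSpace ℝ (Fin d))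
    (hN : HasLaw N (stdGaussian (EuclideanSpace ℝ (Fin d))) P)
    (f : EuclideanSpace ℝ (Fin d) → ℝ) (L : ℝ≥0) (hf : LipschitzWith L f) :
    Integrable (fun ω => f (N ω)) P ∧
    (∀ lam : ℝ,
      Integrable (fun ω => Real.exp (lam * (f (N ω) - ∫ ω', f (N ω') ∂P))) P ∧
      ∫ ω, Real.exp (lam * (f (N ω) - ∫ ω', f (N ω') ∂P)) ∂P
        ≤ Real.exp (lam ^ 2 * (L : ℝ) ^ 2 / 2)) ∧
    (0 < L → ∀ C : ℝ, 0 ≤ C →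
      P.real {ω | C ≤ f (N ω) - ∫ ω', f (N ω') ∂P}
        ≤ Real.exp (-(C ^ 2 / (2 * (L : ℝ) ^ 2)))) ∧
    (L = 0 → ∀ C : ℝ, 0 < C →
      P.real {ω | C ≤ f (N ω) - ∫ ω', f (N ω') ∂P} = 0) := by
  have hcont := hf.continuous
  have hmean : ∫ ω, f (N ω) ∂P = ∫ x, f x ∂stdGaussian (EuclideanSpace ℝ (Fin d)) :=
    hN.integral_comp hcont.aestronglyMeasurable
  have hsub : HasSubgaussianMGF (fun ω ↦ f (N ω) - ∫ ω', f (N ω') ∂P) (L ^ 2) P := by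
    have h := hf.hasSubgaussianMGF_stdGaussian
    rw [← hN.map_eq] at h
    rw [hmean, ← hN.map_eq]
    exact h.of_map hN.aemeasurable
  refine ⟨?_, fun lam ↦ ⟨hsub.integrable_exp_mul lam, ?_⟩, fun _ C hC ↦ ?_, ?_⟩
  · have h := hf.integrable_isGaussian (stdGaussian (EuclideanSpace ℝ (Fin d)))
    rw [← hN.map_eq] at h
    exact h.comp_aemeasurable hN.aemeasurable
  · refine (hsub.mgf_le lam).trans_eq ?_
    push_cast
    ring_nf
  · refine (hsub.measure_ge_le hC).trans_eq ?_
    push_cast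
    rw [neg_div]
  · rintro rfl C hC
    have hconst (x : EuclideanSpace ℝ (Fin d)) : f x = f 0 := by
      simpa [sub_eq_zero] using hf.norm_sub_le x 0
    simp [hconst, hC.not_ge]
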